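/- Let $K$ be a field. For a finite simple graph $G$ on $[n]$ let $S=K[x_1,\dots,x_n,y_1,\dots,y_n]$, $f_{ij}=x_iy_j-x_jy_i$, and let $J_G=(f_{ij} : i<j,\ \{i,j\}\in E(G))\subset S$ be its binomial edge ideal. An ideal $I\subset S$ is of linear type if the natural map $\mathrm{Sym}(I)\to\mathcal R(I)=\bigoplus_{i\ge 0}I^it^i$ is an isomorphism. A relation of degree $d\ge 1$ on the edge binomials is a form of degree $d$ in $S[X_{ij} : i<j,\ \{i,j\}\in E(G)]$ (elements of $S$ having degree $0$) that vanishes under $X_{ij}\mapsto f_{ij}$; $\Lambda_j$ denotes the ideal generated by the relations of degree at most $j$, and the relation type is the least $r\ge 1$ with $\Lambda_r=\bigcup_{j\ge r}\Lambda_j$. For an edge $\{i,j\}$ with $i<j$ put $X_{ji}=-X_{ij}$. Let $C_{4,1}$ be the graph on $[8]$ with edges $\{1,2\},\{2,3\},\{3,4\},\{1,4\},\{1,5\},\{2,6\},\{3,7\},\{4,8\}$. **Proposition.** (1) Suppose $G$ contains $C_{4,1}$ as an induced subgraph. Then $J_G$ is not of linear type: the natural map $\mathrm{Sym}(J_G)\to\mathcal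 R(J_G)$ is not an isomorphism, indeed $\mathrm{Sym}(J_G)$ and $\mathcal R(J_G)$ are not isomorphic as $S$-algebras, and the relation type of the edge binomials of $G$ is not $1$. More precisely, for every embedding $v:[8]\to[n]$ of $C_{4,1}$ as an induced subgraph of $G$, writing $x_k,y_k,X_{kl}$ for $x_{v(k)},y_{v(k)},X_{v(k)v(l)}$, the form $$\begin{aligned}F={}&(x_4x_8y_3y_7-x_3x_8y_4y_7-x_4x_7y_3y_8+x_3x_7y_4y_8)X_{15}X_{26}\\ &+(x_6x_8y_4y_7-x_4x_8y_6y_7-x_6x_7y_4y_8+x_4x_7y_6y_8)X_{15}X_{23}\\ &+(x_3x_8y_5y_7-x_5x_8y_3y_7-x_3x_7y_5y_8+x_5x_7y_3y_8)X_{14}X_{26}\\ &+(x_5x_8y_6y_7-x_6x_8y_5y_7-x_5x_7y_6y_8+x_6x_7y_5y_8)X_{14}X_{23}\\ &+(x_3x_7y_5y_6-x_3x_6y_5y_7-x_3x_5y_6y_7+x_5x_6y_3y_7)X_{12}X_{48}\\ &+(x_4x_6y_5y_8-x_4x_8y_5y_6-x_5x_6y_4y_8+x_4x_5y_6y_8)X_{12}X_{37}\\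 &+(x_7x_8y_5y_6-x_6x_8y_5y_7-x_5x_7y_6y_8+x_5x_6y_7y_8)X_{12}X_{34}\end{aligned}$$ is a relation of degree $2$ on the edge binomials of $G$, and $F\notin\Lambda_1$. (2) $C_{4,1}$ is connected and unicyclic (it contains precisely one cycle as a subgraph). Hence the assertion that $J_G$ is of linear type for every unicyclic graph $G$ is false over every field $K$, even when restricted to connected graphs. -/

import Mathlib

noncomputable section

namespace BinomialEdge

/-! ### Ideals of linear type and relations -/

section General

variable {A : Type*} [CommRing A]

/-- The `A`-linear map `I → 𝓡(I)`, `a ↦ a t`. -/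
def toRees (I : Ideal A) : I →ₗ[A] reesAlgebra I where
  toFun a := ⟨Polynomial.monomial 1 (a : A),
    reesAlgebra.monomial_mem.mpr (by rw [pow_one]; exact a.2)⟩
  map_add' a b := by ext1; simp
  map_smul' r a := by ext1; simp [Polynomial.smul_monomial]

/-- The natural `A`-algebra homomorphism `Sym(I) → 𝓡(I)`. -/
def symToRees (I : Ideal A) : SymmetricAlgebra A I →ₐ[A] reesAlgebra I :=
  SymmetricAlgebra.lift (toRees I)

/-- `I` is of linear type: the natural map `Sym(I) → 𝓡(I)` is an isomorphism. -/
def IsOfLinearType (I : Ideal A) : Prop := Function.Bijective (symToRees I)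

/-- A relation of degree `d` on `z`: a form of degree `d ≥ 1` in `A[X_i]` vanishing at `z`. -/
def IsRelation {ι : Type*} (z : ι → A) (d : ℕ) (F : MvPolynomial ι A) : Prop :=
  1 ≤ d ∧ F.IsHomogeneous d ∧ MvPolynomial.aeval z F = 0

/-- `Λ_j`: the ideal of `A[X_i]` generated by the relations on `z` of degree at most `j`. -/
def relationIdeal {ι : Type*} (z : ι → A) (j : ℕ) : Ideal (MvPolynomial ι A) :=
  Ideal.span {F | ∃ d, d ≤ j ∧ IsRelation z d F}

/-- `r` is the relation type of `z`: the least positive integer with `Λ_r = ⋃_{j ≥ r} Λ_j`. -/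
def HasRelationType {ι : Type*} (z : ι → A) (r : ℕ) : Prop :=
  IsLeast {r : ℕ | 0 < r ∧
    (relationIdeal z r : Set (MvPolynomial ι A)) = ⋃ j ≥ r, (relationIdeal z j : Set _)} r

end General

/-! ### Binomial edge ideals -/

section Edge

/-- The ring `S = K[x_1, …, x_n, y_1, …, y_n]`; the left copy of `Fin n` indexes the `x_i`,
the right copy the `y_i`. -/
abbrev S (K : Type*) [Field K] (n : ℕ) : Type _ := MvPolynomial (Fin n ⊕ Fin n) K

variable (K : Type*) [Field K] {n : ℕ}

/-- The variable `x_i`. -/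
def x (i : Fin n) : S K n := MvPolynomial.X (Sum.inl i)

/-- The variable `y_i`. -/
def y (i : Fin n) : S K n := MvPolynomial.X (Sum.inr i)

/-- `f_{ij} = x_i y_j - x_j y_i`. -/
def f (i j : Fin n) : S K n := x K i * y K j - x K j * y K i

/-- The edges of `G`, each written as the pair `(i, j)` of its endpoints with `i < j`. -/
abbrev Edge (G : SimpleGraph (Fin n)) : Type := {p : Fin n × Fin n // p.1 < p.2 ∧ G.Adj p.1 p.2}

/-- The family of edge binomials `f_{ij}`, `i < j`, `{i,j} ∈ E(G)`. -/
def edgeBinomial (G : SimpleGraph (Fin n)) (e : Edge G) : S K n := f K e.1.1 e.1.2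

/-- The binomial edge ideal `J_G`. -/
def J (G : SimpleGraph (Fin n)) : Ideal (S K n) := Ideal.span (Set.range (edgeBinomial K G))

open Classical in
/-- The variable of `S[X_e | e ∈ E(G)]` attached to an edge with a chosen orientation:
`X_{ij}` if `i < j`, and `-X_{ji}` if `j < i` (as `f_{ij} = -f_{ji}`).
It is set to `0` on pairs that are not edges. -/
def T (G : SimpleGraph (Fin n)) (i j : Fin n) : MvPolynomial (Edge G) (S K n) :=
  if h : i < j ∧ G.Adj i j then MvPolynomial.X ⟨(i, j), h⟩
  else if h : j < i ∧ G.Adj j i then -MvPolynomial.X ⟨(j, i), h⟩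
  else 0

/-- The quadratic form in the edge variables of `G` attached to an eight-tuple `v` of vertices:
`v 0, v 1, v 2, v 3` is the 4-cycle and `v (k + 4)` is the pendant neighbour of `v k`. -/
def quadric (G : SimpleGraph (Fin n)) (v : Fin 8 → Fin n) : MvPolynomial (Edge G) (S K n) :=
  let x (k : Fin 8) : S K n := x K (v k)
  let y (k : Fin 8) : S K n := y K (v k)
  let T (k l : Fin 8) : MvPolynomial (Edge G) (S K n) := T K G (v k) (v l)
  let C : S K n →+* MvPolynomial (Edge G) (S K n) := MvPolynomial.C
  C (x 3 * x 7 * y 2 * y 6 - x 2 * x 7 * y 3 * y 6 - x 3 * x 6 * y 2 * y 7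
      + x 2 * x 6 * y 3 * y 7) * T 0 4 * T 1 5
  + C (x 5 * x 7 * y 3 * y 6 - x 3 * x 7 * y 5 * y 6 - x 5 * x 6 * y 3 * y 7
      + x 3 * x 6 * y 5 * y 7) * T 0 4 * T 1 2
  + C (x 2 * x 7 * y 4 * y 6 - x 4 * x 7 * y 2 * y 6 - x 2 * x 6 * y 4 * y 7
      + x 4 * x 6 * y 2 * y 7) * T 0 3 * T 1 5
  + C (x 4 * x 7 * y 5 * y 6 - x 5 * x 7 * y 4 * y 6 - x 4 * x 6 * y 5 * y 7
      + x 5 * x 6 * y 4 * y 7) * T 0 3 * T 1 2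
  + C (x 2 * x 6 * y 4 * y 5 - x 2 * x 5 * y 4 * y 6 - x 2 * x 4 * y 5 * y 6
      + x 4 * x 5 * y 2 * y 6) * T 0 1 * T 3 7
  + C (x 3 * x 5 * y 4 * y 7 - x 3 * x 7 * y 4 * y 5 - x 4 * x 5 * y 3 * y 7
      + x 3 * x 4 * y 5 * y 7) * T 0 1 * T 2 6
  + C (x 6 * x 7 * y 4 * y 5 - x 5 * x 7 * y 4 * y 6 - x 4 * x 6 * y 5 * y 7
      + x 4 * x 5 * y 6 * y 7) * T 0 1 * T 2 3

end Edge

/-! ### Graphs -/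

/-- The graph `C_{4,1}`: the 4-cycle `0, 1, 2, 3` with a pendant edge `{k, k + 4}` at each `k`. -/
def C41 : SimpleGraph (Fin 8) :=
  SimpleGraph.fromEdgeSet
    {s(0, 1), s(1, 2), s(2, 3), s(0, 3), s(0, 4), s(1, 5), s(2, 6), s(3, 7)}

/-- `G` is unicyclic: precisely one subgraph of `G` is a cycle. -/
def IsUnicyclic {V : Type*} (G : SimpleGraph V) : Prop :=
  ∃! H : G.Subgraph, ∃ m, 3 ≤ m ∧ Nonempty (H.coe ≃g SimpleGraph.cycleGraph m)

end BinomialEdge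

end

/-!
Let `F` be the quadric attached to an induced copy `φ` of `C_{4,1}`. That `F` vanishes at the edge binomials is
a polynomial identity in sixteen variables; the heart of the matter is that `F` is not in `Λ_1`.

*Non-membership.* Consider the point `p` of affine space whose coordinates `(x, y)` are `(0, 0)` at
the vertices `0, 1, 2, 3` of the 4-cycle (and outside the image of `φ`), `(1, 0)` at the pendant
vertices `4, 6` and `(0, 1)` at the pendant vertices `5, 7`. The fibre of `Sym(J_G)` over `p` is a
linear space, cut out by the linear relations with coefficients evaluated at `p`; it contains the
fibre of the Rees algebra, hence every limit of rescaled values of the edge binomials along a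
curve through `p` (`IsRelation.eval₂_eq_zero_of_curve`). Moving the vertices `0` and `1` to
`(t, 0)` and `(0, t)` makes `f₀₁ = t ^ 2` and keeps all other edge binomials zero, so the unit
vector at the edge `{0, 1}` is such a limit; likewise for the edge `{2, 3}`. Their sum is therefore
a common zero of the linear relations over `p`. But `F` restricts to `-(X₀₁ X₂₃ + X₀₃ X₁₂)` on the
edges of the cycle over `p`, so it takes the value `-1` there. Behind this is the classical
relation `(ab)(cd) = (bc)(da)` on the edge ideal of a 4-cycle.

*From `Λ_1` to algebras.* `Sym(I)` is the quotient of `A[X_i]` by `Λ_1`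
(`mem_relationIdeal_one_of_aeval_ι_eq_zero`), so the class of `F` in `Sym(J_G)` is nonzero. It is
killed by the square of any edge binomial (`IsRelation.pow_smul_aeval_ι_eq_zero`), whereas the Rees
algebra sits in `S[t]` and is torsion-free. Thus the two algebras are not isomorphic in any way.
-/

namespace BinomialEdge

open MvPolynomial

/-! ### Relations, symmetric algebras and Rees algebras -/

section General

variable {A : Type*} [CommRing A] {ι : Type*}

theorem IsRelation.mem_relationIdeal {z : ι → A} {d : ℕ} {F : MvPolynomial ι A}
    (hF : IsRelation z d F) : F ∈ relationIdeal z d :=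
  Ideal.subset_span ⟨d, le_rfl, hF⟩

theorem IsRelation.not_hasRelationType_one {z : ι → A} {d : ℕ} {F : MvPolynomial ι A}
    (hF : IsRelation z d F) (hF' : F ∉ relationIdeal z 1) : ¬ HasRelationType z 1 := by
  rintro ⟨⟨-, h⟩, -⟩
  refine hF' ?_
  rw [← SetLike.mem_coe, h]
  exact Set.mem_biUnion hF.1 hF.mem_relationIdeal

theorem eval₂_mul_of_isHomogeneous {B : Type*} [CommRing B] (g : A →+* B) (b : B) (w : ι → B)
    {d : ℕ} {F : MvPolynomial ι A} (hF : F.IsHomogeneous d) :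
    eval₂ g (fun i => b * w i) F = b ^ d * eval₂ g w F := by
  simp only [eval₂_eq, Finset.mul_sum]
  refine Finset.sum_congr rfl fun m hm => ?_
  have hd : ∑ i ∈ m.support, m i = d := (hF.degree_eq_sum_deg_support hm).symm
  simp only [mul_pow, Finset.prod_mul_distrib, Finset.prod_pow_eq_pow_sum, hd]
  ring

theorem eval₂_add_of_isHomogeneous_one {B : Type*} [CommRing B] (g : A →+* B) (v w : ι → B)
    {F : MvPolynomial ι A} (hF : F.IsHomogeneous 1) :
    eval₂ g (v + w) F = eval₂ g v F + eval₂ g w F := by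
  rw [← mem_homogeneousSubmodule, homogeneousSubmodule_one_eq_span_X] at hF
  induction hF using Submodule.span_induction with
  | mem p hp => obtain ⟨i, rfl⟩ := hp; simp
  | zero => simp
  | add p q _ _ hp hq => simp only [eval₂_add, hp, hq]; ring
  | smul a p _ hp => simp only [smul_eq_C_mul, eval₂_mul, eval₂_C, hp]; ring

/-- If the family `z`, restricted to a curve `g : A → k[t]`, is `t ^ N` times a constant vector `w`,
then `w` lies in the fibre of the Rees algebra over the point `t = 0` of the curve: every
relation on `z` vanishes at `w` once its coefficients are evaluated at that point. -/
theorem IsRelation.eval₂_eq_zero_of_curve {k : Type*} [CommRing k] {z : ι → A} {d : ℕ}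
    {F : MvPolynomial ι A} (hF : IsRelation z d F) (g : A →+* Polynomial k) (w : ι → k) (N : ℕ)
    (hg : ∀ i, g (z i) = Polynomial.X ^ N * Polynomial.C (w i)) :
    eval₂ (Polynomial.constantCoeff.comp g) w F = 0 := by
  have h := congrArg g hF.2.2
  rw [map_zero, aeval_def, ← coe_eval₂Hom, Algebra.algebraMap_self, ← RingHom.comp_apply,
    comp_eval₂Hom, RingHom.comp_id, coe_eval₂Hom] at h
  simp only [hg] at h
  rw [eval₂_mul_of_isHomogeneous g _ _ hF.2.1, ← pow_mul,
    ((Polynomial.monic_X_pow (R := k) _).mul_right_eq_zero_iff)] at h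
  have h' := congrArg Polynomial.constantCoeff h
  rw [map_zero, ← coe_eval₂Hom, ← RingHom.comp_apply, comp_eval₂Hom] at h'
  simpa using h'

/-- The generators of an ideal, as elements of that ideal. -/
def gen (z : ι → A) (i : ι) : Ideal.span (Set.range z) :=
  ⟨z i, Ideal.subset_span ⟨i, rfl⟩⟩

/-- The kernel of the presentation `A[X_i] → Sym(I)` is generated by the linear relations. -/
theorem mem_relationIdeal_one_of_aeval_ι_eq_zero (z : ι → A) {F : MvPolynomial ι A}
    (hF : aeval (fun i => SymmetricAlgebra.ι A _ (gen z i)) F = 0) :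
    F ∈ relationIdeal z 1 := by
  let s : (ι →₀ A) →ₗ[A] Ideal.span (Set.range z) := Finsupp.linearCombination A (gen z)
  let t : (ι →₀ A) →ₗ[A] MvPolynomial ι A := Finsupp.linearCombination A X
  let q : MvPolynomial ι A →ₗ[A] MvPolynomial ι A ⧸ relationIdeal z 1 :=
    (Ideal.Quotient.mkₐ A _).toLinearMap
  have hsz (a : ι →₀ A) : (s a : A) = Finsupp.linearCombination A z a := by
    simp [s, Finsupp.linearCombination_apply, Finsupp.sum, gen]
  have hs : Function.Surjective s := by
    rintro ⟨a, ha⟩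
    obtain ⟨c, hc⟩ := (Finsupp.mem_ideal_span_range_iff_exists_finsupp).1 ha
    exact ⟨c, Subtype.ext ((hsz c).trans hc)⟩
  have hst : LinearMap.ker s ≤ LinearMap.ker (q ∘ₗ t) := by
    intro a ha
    rw [LinearMap.mem_ker] at ha ⊢
    refine Ideal.Quotient.eq_zero_iff_mem.2 (Ideal.subset_span ⟨1, le_rfl, le_rfl, ?_, ?_⟩)
    · rw [← mem_homogeneousSubmodule, homogeneousSubmodule_one_eq_span_X,
        Finsupp.mem_span_range_iff_exists_finsupp]
      exact ⟨a, (Finsupp.linearCombination_apply A a).symm⟩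
    · have := hsz a
      rw [ha] at this
      simpa [t, Finsupp.linearCombination_apply, Finsupp.sum] using this.symm
  -- `I` is the quotient of the free module by the syzygies, which are the linear relations.
  let r : Ideal.span (Set.range z) →ₗ[A] MvPolynomial ι A ⧸ relationIdeal z 1 :=
    (LinearMap.ker s).liftQ (q ∘ₗ t) hst ∘ₗ (s.quotKerEquivOfSurjective hs).symm.toLinearMap
  have hr (i : ι) : r (gen z i) = Ideal.Quotient.mkₐ A _ (X i) := by
    have h : gen z i = s (Finsupp.single i 1) := by simp [s]
    have h' : (s.quotKerEquivOfSurjective hs).symm (s (Finsupp.single i 1)) =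
        (LinearMap.ker s).mkQ (Finsupp.single i 1) := by
      rw [LinearEquiv.symm_apply_eq]; rfl
    simp only [r, LinearMap.comp_apply, LinearEquiv.coe_coe, h, h']
    simp [t, q]
  have hcomp : (SymmetricAlgebra.lift r).comp
      (aeval fun i => SymmetricAlgebra.ι A _ (gen z i)) = Ideal.Quotient.mkₐ A _ := by
    ext i
    simp [hr]
  have := DFunLike.congr_fun hcomp F
  rw [AlgHom.comp_apply, hF, map_zero] at this
  exact Ideal.Quotient.eq_zero_iff_mem.1 this.symm

/-- In `Sym(I)` one has `a · b̄ = b · ā` for `a, b ∈ I`, so every relation is torsion there. -/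
theorem IsRelation.pow_smul_aeval_ι_eq_zero {z : ι → A} {d : ℕ} {F : MvPolynomial ι A}
    (hF : IsRelation z d F) (i : ι) :
    z i ^ d • aeval (fun j => SymmetricAlgebra.ι A _ (gen z j)) F = 0 := by
  set σ := fun j => SymmetricAlgebra.ι A _ (gen z j)
  have hσ (j : ι) : algebraMap A (SymmetricAlgebra A _) (z i) * σ j =
      σ i * algebraMap A _ (z j) := by
    have h : z i • gen z j = z j • gen z i := Subtype.ext (mul_comm _ _)
    rw [mul_comm (σ i), ← Algebra.smul_def, ← Algebra.smul_def, ← map_smul, ← map_smul, h]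
  -- `a ^ d F(z̄) = F(a z̄) = F(z ā) = F(z) ā ^ d = 0` for `a = z i`.
  rw [Algebra.smul_def, map_pow, aeval_def, ← eval₂_mul_of_isHomogeneous _ _ _ hF.2.1]
  simp only [hσ]
  rw [eval₂_mul_of_isHomogeneous _ _ _ hF.2.1]
  have h := congrArg (algebraMap A (SymmetricAlgebra A (Ideal.span (Set.range z)))) hF.2.2
  rw [map_zero, aeval_def, ← coe_eval₂Hom, Algebra.algebraMap_self, ← RingHom.comp_apply,
    comp_eval₂Hom, RingHom.comp_id, coe_eval₂Hom] at h
  rw [h, mul_zero]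

/-- A relation outside `Λ_1` gives a nonzero torsion element of `Sym(I)`, while `𝓡(I) ⊆ A[t]` is
torsion-free. -/
theorem IsRelation.isEmpty_algEquiv_reesAlgebra [IsDomain A] {z : ι → A} {d : ℕ}
    {F : MvPolynomial ι A} (hF : IsRelation z d F) (hF' : F ∉ relationIdeal z 1) {i : ι}
    (hi : z i ≠ 0) :
    IsEmpty (SymmetricAlgebra A (Ideal.span (Set.range z)) ≃ₐ[A]
      reesAlgebra (Ideal.span (Set.range z))) := by
  refine ⟨fun e => hF' (mem_relationIdeal_one_of_aeval_ι_eq_zero z ?_)⟩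
  have h := congrArg (fun u => (e u : Polynomial A)) (hF.pow_smul_aeval_ι_eq_zero i)
  simp only [map_smul, map_zero, Subalgebra.coe_smul, Subalgebra.coe_zero] at h
  rw [smul_eq_zero_iff_right (pow_ne_zero _ hi)] at h
  exact (map_eq_zero_iff e e.injective).1 (Subtype.ext h)

theorem IsOfLinearType.nonempty_algEquiv {I : Ideal A} (h : IsOfLinearType I) :
    Nonempty (SymmetricAlgebra A I ≃ₐ[A] reesAlgebra I) :=
  ⟨AlgEquiv.ofBijective _ h⟩

end General

/-! ### The quadric of an induced `C_{4,1}` -/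

section Edge

variable (K : Type*) [Field K] {n : ℕ}

theorem f_swap (i j : Fin n) : f K j i = -f K i j := by
  simp only [f]; ring

/-- The sign convention `X_{ji} = -X_{ij}` is respected by evaluation at edge values that come from
an antisymmetric function `h`. -/
theorem eval₂_T {B : Type*} [CommRing B] (g : S K n →+* B) {G : SimpleGraph (Fin n)}
    (h : Fin n → Fin n → B) (hh : ∀ i j, h j i = -h i j) {i j : Fin n} (hij : G.Adj i j) :
    eval₂ g (fun e : Edge G => h e.1.1 e.1.2) (T K G i j) = h i j := by
  unfold T
  split_ifs with h1 h2
  · simp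
  · simp [hh j i]
  · rcases lt_trichotomy i j with hlt | heq | hgt
    · exact absurd ⟨hlt, hij⟩ h1
    · exact absurd heq hij.ne
    · exact absurd ⟨hgt, hij.symm⟩ h2

theorem isHomogeneous_T (G : SimpleGraph (Fin n)) (i j : Fin n) :
    (T K G i j).IsHomogeneous 1 := by
  unfold T
  split_ifs
  · exact isHomogeneous_X _ _
  · exact (isHomogeneous_X _ _).neg
  · exact isHomogeneous_zero _ _ _

theorem isHomogeneous_quadric (G : SimpleGraph (Fin n)) (v : Fin 8 → Fin n) :
    (quadric K G v).IsHomogeneous 2 := by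
  have h (c : S K n) (i j k l : Fin n) :
      (MvPolynomial.C c * T K G i j * T K G k l).IsHomogeneous 2 := by
    simpa using
      ((isHomogeneous_C _ c).mul (isHomogeneous_T K G i j)).mul (isHomogeneous_T K G k l)
  unfold quadric
  exact ((((((h _ _ _ _ _).add (h _ _ _ _ _)).add (h _ _ _ _ _)).add (h _ _ _ _ _)).add
    (h _ _ _ _ _)).add (h _ _ _ _ _)).add (h _ _ _ _ _)

theorem C41_adj_iff (k l : Fin 8) : C41.Adj k l ↔
    s(k, l) ∈ ({s(0, 1), s(1, 2), s(2, 3), s(0, 3), s(0, 4), s(1, 5), s(2, 6), s(3, 7)} :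
      Finset (Sym2 (Fin 8))) ∧ k ≠ l := by
  simp [C41]

instance : DecidableRel C41.Adj := fun k l => decidable_of_iff _ (C41_adj_iff k l).symm

theorem isRelation_quadric {G : SimpleGraph (Fin n)} (φ : C41 ↪g G) :
    IsRelation (edgeBinomial K G) 2 (quadric K G φ) := by
  refine ⟨by norm_num, isHomogeneous_quadric K G φ, ?_⟩
  have hT (k l : Fin 8) (h : C41.Adj k l) :
      eval₂ (algebraMap (S K n) (S K n)) (edgeBinomial K G) (T K G (φ k) (φ l)) =
        f K (φ k) (φ l) :=
    eval₂_T K _ (f K) (f_swap K) (φ.map_rel_iff.2 h)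
  simp only [aeval_def, quadric, eval₂_add, eval₂_mul, eval₂_C]
  simp (disch := decide) only [hT]
  simp only [f, Algebra.algebraMap_self, RingHom.id_apply]
  ring

variable {K}

/-- The `K`-algebra homomorphism that evaluates the variables at the point with coordinates
`(α k, β k)` at the vertex `v k` and `(0, 0)` at the vertices outside the range of `v`. -/
noncomputable def evalAt {B : Type*} [CommRing B] [Algebra K B] (v : Fin 8 → Fin n)
    (α β : Fin 8 → B) : S K n →ₐ[K] B :=
  aeval (Sum.elim (Function.extend v α 0) (Function.extend v β 0))

section evalAt

variable {B : Type*} [CommRing B] [Algebra K B] {v : Fin 8 → Fin n}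

theorem evalAt_x (hv : Function.Injective v) (α β : Fin 8 → B) (k : Fin 8) :
    evalAt v α β (x K (v k)) = α k := by
  simp [evalAt, x, hv.extend_apply]

theorem evalAt_y (hv : Function.Injective v) (α β : Fin 8 → B) (k : Fin 8) :
    evalAt v α β (y K (v k)) = β k := by
  simp [evalAt, y, hv.extend_apply]

theorem evalAt_f (hv : Function.Injective v) (α β : Fin 8 → B) (k l : Fin 8) :
    evalAt v α β (f K (v k) (v l)) = α k * β l - α l * β k := by
  simp only [f, map_sub, map_mul, evalAt_x hv, evalAt_y hv]

theorem evalAt_f_eq_zero (α β : Fin 8 → B) {i j : Fin n}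
    (h : ¬ ((∃ k, v k = i) ∧ ∃ l, v l = j)) : evalAt v α β (f K i j) = 0 := by
  rcases not_and_or.1 h with h | h <;>
    simp [evalAt, f, x, y, Function.extend_apply' _ _ _ h]

end evalAt

theorem constantCoeff_comp_evalAt (v : Fin 8 → Fin n) {α β : Fin 8 → Polynomial K}
    {a b : Fin 8 → K} (hα : ∀ k, (α k).coeff 0 = a k) (hβ : ∀ k, (β k).coeff 0 = b k) :
    Polynomial.constantCoeff.comp (evalAt v α β : S K n →ₐ[K] Polynomial K).toRingHom =
      (evalAt v a b : S K n →ₐ[K] K).toRingHom := by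
  refine ringHom_ext (fun c => by simp [evalAt]) ?_
  rintro (i | i) <;> by_cases h : ∃ k, v k = i <;>
    simp [evalAt, Function.extend_def, h, hα, hβ]

/-- The hypothesis of `IsRelation.eval₂_eq_zero_of_curve` for the edge binomials of `G` needs to be
checked on the edges of `C_{4,1}` only: as the copy is induced, any other edge of `G` has an
endpoint at which the curve stays at the origin. -/
theorem evalAt_edgeBinomial_curve {G : SimpleGraph (Fin n)} (φ : C41 ↪g G)
    {α β : Fin 8 → Polynomial K} {a b : Fin 8 → K} {N : ℕ}
    (h : ∀ k l, C41.Adj k l →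
      α k * β l - α l * β k = Polynomial.X ^ N * Polynomial.C (a k * b l - a l * b k))
    (e : Edge G) :
    evalAt φ α β (edgeBinomial K G e) =
      Polynomial.X ^ N * Polynomial.C (evalAt φ a b (edgeBinomial K G e)) := by
  obtain ⟨⟨i, j⟩, hlt, hadj⟩ := e
  by_cases hij : (∃ k, φ k = i) ∧ ∃ l, φ l = j
  · obtain ⟨⟨k, rfl⟩, ⟨l, rfl⟩⟩ := hij
    simp only [edgeBinomial, evalAt_f φ.injective]
    exact h k l (φ.map_rel_iff.1 hadj)
  · simp only [edgeBinomial, evalAt_f_eq_zero _ _ hij, map_zero, mul_zero]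

variable (K)

theorem quadric_notMem_relationIdeal_one {G : SimpleGraph (Fin n)} (φ : C41 ↪g G) :
    quadric K G φ ∉ relationIdeal (edgeBinomial K G) 1 := by
  -- `g` is evaluation at a point `p`, and `w₀₁`, `w₂₃` are the limits at `p` of the rescaled edge
  -- binomials along the curves that open up the edges `{0, 1}` and `{2, 3}`; the linear relations
  -- vanish at `w₀₁ + w₂₃`, where the quadric takes the value `-1`.
  let g : S K n →+* K :=
    (evalAt φ ![0, 0, 0, 0, 1, 0, 1, 0] ![0, 0, 0, 0, 0, 1, 0, 1] : S K n →ₐ[K] K).toRingHom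
  let ev₀₁ : S K n →ₐ[K] K := evalAt φ ![1, 0, 0, 0, 0, 0, 0, 0] ![0, 1, 0, 0, 0, 0, 0, 0]
  let ev₂₃ : S K n →ₐ[K] K := evalAt φ ![0, 0, 1, 0, 0, 0, 0, 0] ![0, 0, 0, 1, 0, 0, 0, 0]
  let w₀₁ (e : Edge G) : K := ev₀₁ (edgeBinomial K G e)
  let w₂₃ (e : Edge G) : K := ev₂₃ (edgeBinomial K G e)
  have hle : relationIdeal (edgeBinomial K G) 1 ≤ RingHom.ker (eval₂Hom g (w₀₁ + w₂₃)) := by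
    refine Ideal.span_le.2 ?_
    rintro F ⟨d, hd, hF⟩
    obtain rfl : d = 1 := le_antisymm hd hF.1
    have h₀₁ := hF.eval₂_eq_zero_of_curve (evalAt φ
      ![Polynomial.X, 0, 0, 0, 1, 0, 1, 0] ![0, Polynomial.X, 0, 0, 0, 1, 0, 1] :
        S K n →ₐ[K] Polynomial K).toRingHom w₀₁ 2 (evalAt_edgeBinomial_curve φ (by
          intro k l hkl
          fin_cases k <;> fin_cases l <;>
            first | exact absurd hkl (by decide) | simp [pow_two]))
    rw [constantCoeff_comp_evalAt φ (a := ![0, 0, 0, 0, 1, 0, 1, 0])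
      (b := ![0, 0, 0, 0, 0, 1, 0, 1]) (by intro k; fin_cases k <;> simp)
      (by intro k; fin_cases k <;> simp)] at h₀₁
    have h₂₃ := hF.eval₂_eq_zero_of_curve (evalAt φ
      ![0, 0, Polynomial.X, 0, 1, 0, 1, 0] ![0, 0, 0, Polynomial.X, 0, 1, 0, 1] :
        S K n →ₐ[K] Polynomial K).toRingHom w₂₃ 2 (evalAt_edgeBinomial_curve φ (by
          intro k l hkl
          fin_cases k <;> fin_cases l <;>
            first | exact absurd hkl (by decide) | simp [pow_two]))
    rw [constantCoeff_comp_evalAt φ (a := ![0, 0, 0, 0, 1, 0, 1, 0])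
      (b := ![0, 0, 0, 0, 0, 1, 0, 1]) (by intro k; fin_cases k <;> simp)
      (by intro k; fin_cases k <;> simp)] at h₂₃
    rw [SetLike.mem_coe, RingHom.mem_ker, coe_eval₂Hom, eval₂_add_of_isHomogeneous_one _ _ _ hF.2.1,
      h₀₁, h₂₃, add_zero]
  intro hmem
  have h := hle hmem
  have hT (k l : Fin 8) (hkl : C41.Adj k l) :
      eval₂ g (w₀₁ + w₂₃) (T K G (φ k) (φ l)) =
        ev₀₁ (f K (φ k) (φ l)) + ev₂₃ (f K (φ k) (φ l)) :=
    eval₂_T K g (fun i j => ev₀₁ (f K i j) + ev₂₃ (f K i j))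
      (fun i j => by rw [f_swap, map_neg, map_neg, neg_add]) (φ.map_rel_iff.2 hkl)
  rw [RingHom.mem_ker, coe_eval₂Hom] at h
  simp only [quadric, eval₂_add, eval₂_mul, eval₂_C] at h
  simp (disch := decide) only [hT] at h
  simp [g, ev₀₁, ev₂₃, evalAt_f φ.injective, evalAt_x φ.injective, evalAt_y φ.injective] at h

theorem f_ne_zero {i j : Fin n} (h : i ≠ j) : f K i j ≠ 0 := by
  intro h0
  have := congrArg (aeval (Sum.elim (Pi.single i 1) (Pi.single j 1)) : S K n →ₐ[K] K) h0
  simp [f, x, y, h, h.symm] at this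

theorem isEmpty_algEquiv {G : SimpleGraph (Fin n)} (φ : C41 ↪g G) :
    IsEmpty (SymmetricAlgebra (S K n) (J K G) ≃ₐ[S K n] reesAlgebra (J K G)) := by
  obtain ⟨e⟩ : Nonempty (Edge G) := by
    have h : G.Adj (φ 0) (φ 1) := φ.map_rel_iff.2 (by decide)
    rcases lt_or_gt_of_ne h.ne with hlt | hlt
    · exact ⟨⟨(φ 0, φ 1), hlt, h⟩⟩
    · exact ⟨⟨(φ 1, φ 0), hlt, h.symm⟩⟩
  exact (isRelation_quadric K φ).isEmpty_algEquiv_reesAlgebra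
    (quadric_notMem_relationIdeal_one K φ) (i := e) (f_ne_zero K e.2.1.ne)

end Edge

/-! ### The graph `C_{4,1}` is connected and unicyclic -/

theorem C41_connected : C41.Connected := by
  rw [SimpleGraph.connected_iff_exists_forall_reachable]
  have h (k l : Fin 8) (hkl : C41.Adj k l) : C41.Reachable k l := hkl.reachable
  have h1 := h 0 1 (by decide)
  have h2 := h1.trans (h 1 2 (by decide))
  have h3 := h 0 3 (by decide)
  refine ⟨0, fun k => ?_⟩
  fin_cases k
  · exact SimpleGraph.Reachable.refl _
  · exact h1
  · exact h2
  · exact h3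
  · exact h 0 4 (by decide)
  · exact h1.trans (h 1 5 (by decide))
  · exact h2.trans (h 2 6 (by decide))
  · exact h3.trans (h 3 7 (by decide))

theorem exists_adj_adj_of_iso_cycleGraph {V : Type*} {G : SimpleGraph V} {m : ℕ} (hm : 3 ≤ m)
    (e : G ≃g SimpleGraph.cycleGraph m) (v : V) : ∃ a b, a ≠ b ∧ G.Adj v a ∧ G.Adj v b := by
  obtain ⟨m, rfl⟩ : ∃ p, m = p + 3 := ⟨m - 3, by omega⟩
  have h : Finset.card ((SimpleGraph.cycleGraph (m + 3)).neighborFinset (e v)) = 2 :=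
    SimpleGraph.cycleGraph_degree_three_le
  obtain ⟨a, b, hab, h⟩ := Finset.card_eq_two.1 h
  have key (c : Fin (m + 3)) (hc : c ∈ ({a, b} : Finset (Fin (m + 3)))) :
      G.Adj v (e.symm c) := by
    rw [← h, SimpleGraph.mem_neighborFinset] at hc
    rw [← e.map_adj_iff, e.apply_symm_apply]
    exact hc
  exact ⟨e.symm a, e.symm b, e.symm.injective.ne hab, key a (by simp), key b (by simp)⟩

theorem isUnicyclic_C41 : IsUnicyclic C41 := by
  refine ⟨(⊤ : C41.Subgraph).induce {k | k < 4}, ⟨4, by norm_num, ⟨?_⟩⟩, ?_⟩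
  · refine SimpleGraph.Iso.symm ⟨⟨fun k => ⟨k.castLE (by norm_num), ?_⟩,
      fun k => ⟨k.1, Fin.lt_def.1 k.2⟩, fun k => rfl, fun k => rfl⟩, ?_⟩
    · exact Fin.lt_def.2 k.2
    · intro k l
      revert k l
      simp only [SimpleGraph.Subgraph.coe_adj, SimpleGraph.Subgraph.induce_adj,
        SimpleGraph.Subgraph.top_adj, Equiv.coe_fn_mk, Set.mem_ofPred_eq]
      decide
  · rintro H ⟨m, hm, ⟨e⟩⟩
    have hne : H.verts.Nonempty := ⟨_, (e.symm ⟨0, by omega⟩).2⟩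
    have hdeg (v : Fin 8) (hv : v ∈ H.verts) : ∃ a b, a ≠ b ∧ H.Adj v a ∧ H.Adj v b := by
      obtain ⟨a, b, hab, ha, hb⟩ := exists_adj_adj_of_iso_cycleGraph hm e ⟨v, hv⟩
      exact ⟨a, b, Subtype.coe_injective.ne hab, ha, hb⟩
    -- The pendant vertices have only one neighbour.
    have hlt (v : Fin 8) (hv : v ∈ H.verts) : v < 4 := by
      obtain ⟨a, b, hab, ha, hb⟩ := hdeg v hv
      have : ∀ v a b : Fin 8, a ≠ b → C41.Adj v a → C41.Adj v b → v < 4 := by decide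
      exact this v a b hab ha.adj_sub hb.adj_sub
    -- A vertex of the 4-cycle has only two neighbours on it, and `H` uses both.
    have hadj (v c : Fin 8) (hv : v ∈ H.verts) (hc : c < 4) (hvc : C41.Adj v c) :
        H.Adj v c := by
      obtain ⟨a, b, hab, ha, hb⟩ := hdeg v hv
      have : ∀ v a b c : Fin 8, a < 4 → b < 4 → c < 4 → a ≠ b → C41.Adj v a → C41.Adj v b →
        C41.Adj v c → c = a ∨ c = b := by decide
      rcases this v a b c (hlt a ha.snd_mem) (hlt b hb.snd_mem) hc hab ha.adj_sub hb.adj_sub hvc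
        with rfl | rfl
      · exact ha
      · exact hb
    have hnext (v c : Fin 8) (hc : c < 4) (hvc : C41.Adj v c) (hv : v ∈ H.verts) : c ∈ H.verts :=
      (hadj v c hv hc hvc).snd_mem
    have h01 := hnext 0 1 (by decide) (by decide)
    have h12 := hnext 1 2 (by decide) (by decide)
    have h23 := hnext 2 3 (by decide) (by decide)
    have h30 := hnext 3 0 (by decide) (by decide)
    have hverts : H.verts = {k | k < 4} := by
      refine Set.Subset.antisymm hlt ?_
      obtain ⟨v, hv⟩ := hne
      have hv4 := hlt v hv
      have h0 : (0 : Fin 8) ∈ H.verts := by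
        fin_cases v <;> first | exact absurd hv4 (by decide) | tauto
      intro k hk
      fin_cases k <;> first | exact absurd hk (by decide) | tauto
    ext k l
    · rw [hverts]; rfl
    · simp only [SimpleGraph.Subgraph.induce_adj, SimpleGraph.Subgraph.top_adj]
      constructor
      · intro h
        exact ⟨hlt k h.fst_mem, hlt l h.snd_mem, h.adj_sub⟩
      · rintro ⟨hk, hl, h⟩
        exact hadj k l (hverts ▸ hk) hl h

end BinomialEdge

theorem mainTheorem4 {K : Type*} [Field K] :
    (∀ (n : ℕ) (G : SimpleGraph (Fin n)) (φ : BinomialEdge.C41 ↪g G),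
      ¬ BinomialEdge.IsOfLinearType (BinomialEdge.J K G) ∧
      IsEmpty (SymmetricAlgebra (BinomialEdge.S K n) (BinomialEdge.J K G)
        ≃ₐ[BinomialEdge.S K n] reesAlgebra (BinomialEdge.J K G)) ∧
      ¬ BinomialEdge.HasRelationType (BinomialEdge.edgeBinomial K G) 1 ∧
      BinomialEdge.IsRelation (BinomialEdge.edgeBinomial K G) 2 (BinomialEdge.quadric K G φ) ∧
      BinomialEdge.quadric K G φ ∉
        BinomialEdge.relationIdeal (BinomialEdge.edgeBinomial K G) 1) ∧
    BinomialEdge.C41.Connected ∧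
    BinomialEdge.IsUnicyclic BinomialEdge.C41 ∧
    ¬ ∀ (n : ℕ) (G : SimpleGraph (Fin n)), G.Connected → BinomialEdge.IsUnicyclic G →
        BinomialEdge.IsOfLinearType (BinomialEdge.J K G) := by
  have hlin (n : ℕ) (G : SimpleGraph (Fin n)) (φ : BinomialEdge.C41 ↪g G) :
      ¬ BinomialEdge.IsOfLinearType (BinomialEdge.J K G) := fun h =>
    (BinomialEdge.isEmpty_algEquiv K φ).elim h.nonempty_algEquiv.some
  refine ⟨fun n G φ => ⟨hlin n G φ, BinomialEdge.isEmpty_algEquiv K φ, ?_,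
    BinomialEdge.isRelation_quadric K φ, BinomialEdge.quadric_notMem_relationIdeal_one K φ⟩,
    BinomialEdge.C41_connected, BinomialEdge.isUnicyclic_C41, fun h => ?_⟩
  · exact (BinomialEdge.isRelation_quadric K φ).not_hasRelationType_one
      (BinomialEdge.quadric_notMem_relationIdeal_one K φ)
  · exact hlin 8 _ SimpleGraph.Embedding.refl
      (h 8 _ BinomialEdge.C41_connected BinomialEdge.isUnicyclic_C41)
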